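/- For positive integers $m,n$ let $K_m\times P_n$ and $P_m\times P_n$ be the Cartesian products of the complete graph, resp. the path, of order $m$ with the path of order $n$, on the common vertex set $\{v_{i,j}:1\le i\le m,\ 1\le j\le n\}$, where $v_{i,j}$ lies in row $i$ and in column $I_j=\{v_{1,j},\dots,v_{m,j}\}$. A connected set of a graph $G$ is a nonempty vertex set $C$ such that the induced subgraph $G[C]$ is connected; $N(G)$ is the number of connected sets of $G$, and $c(G)$ the number of components of $G$. Let $\mathcal C_{m,n}$ be the set of connected sets of $K_m\times P_n$ that meet every column, let $\mathcal C'_{m,n}\subseteq\mathcal C_{m,n}$ consist of those that are not connected sets of $P_m\times P_n$, and put $N_{m,n}=|\mathcal C_{m,n}|$. For a nonempty vertex set $X$ let $N(K_m\times P_n;X)$ and $N'(K_m\times P_n;X)$ be the numbers of $C\in\mathcal C_{m,n}$ and of $C\in\mathcal C'_{m,n}$, respectively, such that $C\cap I_j=X\cap I_j$ whenever $X\cap I_j\ne\emptyset$. For a set $S\subseteq\{1,\dots,m\}$ of rows write $S_j=\{v_{i,j}:i\in S\}$. For sets $S,T$ of rows with $S\cap T\neq\emptyset$, define numbers $L_n(S)$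 ($n\ge1$) and $L_n(S,T)$ ($n\ge 2$) recursively as follows. * $L_1(S)=N'(K_m\times P_1;S_1)$, $L_2(S,T)=N'(K_m\times P_2;S_2\cup T_1)$, and for $n\ge2$, $L_n(S)=\sum_{X:\,X\cap S\ne\emptyset}L_n(S,X)$, the sum being over sets $X$ of rows. * Let $n\ge3$ and $G=P_m\times P_n$. 1. If some component of $G[S_n]$ is also a component of $G[S_n\cup T_{n-1}]$, then $L_n(S,T)=N(K_m\times P_{n-1};T_{n-1})$. 2. Otherwise, if $c(G[S_n\cup T_{n-1}])=c(G[T_{n-1}])$, then $L_n(S,T)=L_{n-1}(T)$. 3. Otherwise $L_n(S,T)=\sum_{X:\,X\cap T\ne\emptyset}\lambda(X)$, where * (i) $\lambda(X)=N(K_m\times P_{n-2};X_{n-2})$ if some component of $G[S_n\cup T_{n-1}]$ is also a component of $G[S_n\cup T_{n-1}\cup X_{n-2}]$; * (ii) otherwise, $\lambda(X)=L_{n-2}(X)$ if $c(G[S_n\cup T_{n-1}\cup X_{n-2}])=c(G[X_{n-2}])$; * (iii) otherwise, let $R_1,\dots,R_r$ be the components of $G[X_{n-2}]$ in increasing order of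 their rows, and let $l_i$ and $\bar l_i$ be the smallest and the largest $q$ such that $v_{q,n-2}$ lies in the component of $G[S_n\cup T_{n-1}\cup X_{n-2}]$ that contains $R_i$. If for all $i_1\le i_2$ one has $l_{i_1}=l_{i_2}$ if and only if $l_{i_3}=l_{i_1}$ for every $i_3$ with $i_1\le i_3\le i_2$, then $\lambda(X)=L_{n-1}(F,X)$ with $F=\bigcup_{i=1}^r\{j:l_i\le j\le\bar l_i\}$; * in the remaining case $\lambda(X)=0$. Put $N'_{m,n}=\sum_{\emptyset\ne S\subseteq\{1,\dots,m\}}L_n(S)$. **Theorem.** For all positive integers $m$ and $n$, $N'_{m,n}\le|\mathcal C'_{m,n}|$ and $$N(P_m\times P_n)\le\sum_{k=1}^n(N_{m,k}-N'_{m,k})(n-k+1),$$ and equality holds in the second inequality when $m=3$ or $m=4$. -/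

import Mathlib

namespace GridConn

/-- The grid graph `P_m × P_n`; the vertex `(i, j)` lies in row `i` and column `j`
(both counted from `0`). -/
def PP (m n : ℕ) : SimpleGraph (Fin m × Fin n) :=
  SimpleGraph.boxProd (SimpleGraph.pathGraph m) (SimpleGraph.pathGraph n)

/-- The Cartesian product `K_m × P_n`, on the same vertex set as `P_m × P_n`. -/
def KP (m n : ℕ) : SimpleGraph (Fin m × Fin n) :=
  SimpleGraph.boxProd (⊤ : SimpleGraph (Fin m)) (SimpleGraph.pathGraph n)

/-- `C` is a connected set of `G`: the induced subgraph `G[C]` is connected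
(`SimpleGraph.Connected` includes being nonempty). -/
def IsConnSet {V : Type*} (G : SimpleGraph V) (C : Finset V) : Prop :=
  (G.induce (C : Set V)).Connected

open Classical in
/-- `N(G)`, the number of connected sets of `G`. -/
noncomputable def numConn {V : Type*} [Fintype V] (G : SimpleGraph V) : ℕ :=
  (Finset.univ.filter fun C : Finset V => IsConnSet G C).card

open Classical in
/-- The family `C_{m,n}` of the connected sets of `K_m × P_n` that meet every column. -/
noncomputable def spanning (m n : ℕ) : Finset (Finset (Fin m × Fin n)) :=
  Finset.univ.filter fun C => IsConnSet (KP m n) C ∧ ∀ j : Fin n, ∃ i : Fin m, (i, j) ∈ C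

open Classical in
/-- The family `C'_{m,n}` of the members of `C_{m,n}` that are not connected sets of
`P_m × P_n`. -/
noncomputable def spanning' (m n : ℕ) : Finset (Finset (Fin m × Fin n)) :=
  (spanning m n).filter fun C => ¬ IsConnSet (PP m n) C

/-- `C` and `X` have the same intersection with each column that `X` meets. -/
def Agrees {m n : ℕ} (C X : Finset (Fin m × Fin n)) : Prop :=
  ∀ j : Fin n, (∃ i : Fin m, (i, j) ∈ X) → ∀ i : Fin m, (i, j) ∈ C ↔ (i, j) ∈ X

open Classical in
/-- `N(K_m × P_n; X)`: the number of members of `C_{m,n}` that agree with `X`. -/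
noncomputable def countK (m n : ℕ) (X : Finset (Fin m × Fin n)) : ℕ :=
  ((spanning m n).filter fun C => Agrees C X).card

open Classical in
/-- `N'(K_m × P_n; X)`: the number of members of `C'_{m,n}` that agree with `X`. -/
noncomputable def countK' (m n : ℕ) (X : Finset (Fin m × Fin n)) : ℕ :=
  ((spanning' m n).filter fun C => Agrees C X).card

/-- The copy in column `j` of a set `S` of rows. -/
def col {m n : ℕ} (j : Fin n) (S : Finset (Fin m)) : Finset (Fin m × Fin n) :=
  S ×ˢ {j}

/-- `u` and `v` are vertices in the same component of `G[A]`. -/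
def SameComp {V : Type*} (G : SimpleGraph V) (A : Finset V) (u v : V) : Prop :=
  ∃ (hu : u ∈ (A : Set V)) (hv : v ∈ (A : Set V)),
    (G.induce (A : Set V)).Reachable ⟨u, hu⟩ ⟨v, hv⟩

open Classical in
/-- The vertex sets of the components of `G[A]`; its cardinality is `c(G[A])`. -/
noncomputable def comps {V : Type*} (G : SimpleGraph V) (A : Finset V) : Finset (Finset V) :=
  A.image fun u => A.filter fun v => SameComp G A u v

/-- Some component of `G[A]` is also a component of `G[B]`. -/
def SharesComp {V : Type*} (G : SimpleGraph V) (A B : Finset V) : Prop :=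
  ∃ D, D ∈ comps G A ∧ D ∈ comps G B

section Window

/-! Three consecutive columns `n-2`, `n-1`, `n` of `P_m × P_n` are the columns `0`, `1`, `2` of
`P_m × P_3`. In the following `X`, `T`, `S` are the sets of rows occupied in these columns. -/

variable {m : ℕ}

/-- `S` in column `n`. -/
def wS (S : Finset (Fin m)) : Finset (Fin m × Fin 3) := col 2 S

/-- `T` in column `n-1`. -/
def wT (T : Finset (Fin m)) : Finset (Fin m × Fin 3) := col 1 T

/-- `X` in column `n-2`. -/
def wX (X : Finset (Fin m)) : Finset (Fin m × Fin 3) := col 0 X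

/-- `S` in column `n` together with `T` in column `n-1`. -/
def wST (S T : Finset (Fin m)) : Finset (Fin m × Fin 3) := wS S ∪ wT T

/-- `S` in column `n`, `T` in column `n-1`, and `X` in column `n-2`. -/
def wSTX (S T X : Finset (Fin m)) : Finset (Fin m × Fin 3) := wS S ∪ wT T ∪ wX X

open Classical in
/-- The rows `q` such that the vertex in row `q` of column `n-2` lies in the component of
`P_m × P_n[S ∪ T ∪ X]` that contains the vertex in row `x` of column `n-2`. -/
noncomputable def rowsOf (S T X : Finset (Fin m)) (x : Fin m) : Finset (Fin m) :=
  Finset.univ.filter fun q => SameComp (PP m 3) (wSTX S T X) (x, 0) (q, 0)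

/-- If the row `x ∈ X` belongs to the component `R_i` of `P_m × P_{n-2}[X]`, this is `l_i`, the
smallest row in column `n-2` of the component of `P_m × P_n[S ∪ T ∪ X]` that contains `R_i`
(`Finset.min` takes the value `⊤` only on the empty set). -/
noncomputable def low (S T X : Finset (Fin m)) (x : Fin m) : WithTop (Fin m) :=
  (rowsOf S T X x).min

/-- Likewise the largest such row. -/
noncomputable def high (S T X : Finset (Fin m)) (x : Fin m) : WithBot (Fin m) :=
  (rowsOf S T X x).max

/-- For all `i₁ ≤ i₂`: `l_{i₁} = l_{i₂}` if and only if `l_{i₃} = l_{i₁}` for every `i₃` with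
`i₁ ≤ i₃ ≤ i₂`. The components `R_1, …, R_r` of `P_m × P_{n-2}[X]` are ordered by their rows and
`l` is constant on each of them, so the indices may be replaced by rows in `X`. -/
def Consecutive (S T X : Finset (Fin m)) : Prop :=
  ∀ x ∈ X, ∀ y ∈ X, x ≤ y →
    (low S T X x = low S T X y ↔ ∀ z ∈ X, x ≤ z → z ≤ y → low S T X z = low S T X x)

open Classical in
/-- The rows `j` with `l_i ≤ j ≤ \bar l_i` for some `i`. -/
noncomputable def fill (S T X : Finset (Fin m)) : Finset (Fin m) :=
  Finset.univ.filter fun j =>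
    ∃ x ∈ X, low S T X x ≤ (j : WithTop (Fin m)) ∧ (j : WithBot (Fin m)) ≤ high S T X x

end Window

open Classical in
mutual

/-- The lower bound for `N'(K_m × P_n; S_n)` given by the recurrences (`n ≥ 1`). It is the exact
value for `n = 1`, and the sum of the two-column values for `n ≥ 2`. -/
noncomputable def lowerOne (m : ℕ) : ℕ → Finset (Fin m) → ℕ
  | 0, _ => 0
  | 1, S => countK' m 1 (col 0 S)
  | n + 2, S =>
      ∑ X ∈ Finset.univ.filter (fun X : Finset (Fin m) => (X ∩ S).Nonempty),
        lowerTwo m (n + 2) S X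
termination_by n _ => (n, 1)

/-- The lower bound for `N'(K_m × P_n; S_n ∪ T_{n-1})` given by the recurrences (`n ≥ 2`). It is
the exact value for `n = 2`. -/
noncomputable def lowerTwo (m : ℕ) : ℕ → Finset (Fin m) → Finset (Fin m) → ℕ
  | 0, _, _ => 0
  | 1, _, _ => 0
  | 2, S, T => countK' m 2 (col 1 S ∪ col 0 T)
  | n + 3, S, T =>
      if SharesComp (PP m 3) (wS S) (wST S T) then
        countK m (n + 2) (col (Fin.last (n + 1)) T)
      else if (comps (PP m 3) (wST S T)).card = (comps (PP m 3) (wT T)).card then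
        lowerOne m (n + 2) T
      else
        ∑ X ∈ Finset.univ.filter (fun X : Finset (Fin m) => (X ∩ T).Nonempty),
          if SharesComp (PP m 3) (wST S T) (wSTX S T X) then
            countK m (n + 1) (col (Fin.last n) X)
          else if (comps (PP m 3) (wSTX S T X)).card = (comps (PP m 3) (wX X)).card then
            lowerOne m (n + 1) X
          else if Consecutive S T X then
            lowerTwo m (n + 2) (fill S T X) X
          else 0
termination_by n _ _ => (n, 0)

end

/-- `N_{m,n}`, the number of connected sets of `K_m × P_n` that meet every column. -/
noncomputable def NK (m n : ℕ) : ℕ := (spanning m n).card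

open Classical in
/-- `N'_{m,n}`, the lower bound for `|C'_{m,n}|` given by the recurrences. -/
noncomputable def NK' (m n : ℕ) : ℕ :=
  ∑ S ∈ Finset.univ.filter (fun S : Finset (Fin m) => S.Nonempty), lowerOne m n S

end GridConn

namespace GridConn

-- Components of induced subgraphs and gluing along a separator.

section SameComp

variable {V W : Type*} {G : SimpleGraph V} {H : SimpleGraph W} {A B : Finset V} {u v w : V}

-- Cut a vertex set of the grid along a column into the older part `A` and a window `B` of its last
-- two or three columns, with that column `I` in common. An edge changes the column by at most one,
-- so each edge lies in `A` or in `B`. Hence a component of `B` that avoids `I` disconnects the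
-- union; otherwise connectedness depends on `B` only through the partition that its components
-- induce on `I` (`not_isConnSet_union`, `isConnSet_union_congr`).
--
-- The branches of the recurrence express this. If a window component avoids `I`, every extension
-- connected in `K_m × P_n` is counted. If `B` and `I` have equally many components, the window
-- merges nothing in `I` and can be dropped. Otherwise, if the classes of the partition are
-- consecutive along the column, a single new column made of the intervals they span induces the
-- same partition, so three columns shrink to two (`isConnSet_fill_iff`). All these steps are exact;
-- the only loss is the value `0` for a partition that is not consecutive. Such a partition needs
-- three pairwise nonadjacent occupied rows, hence five rows, so nothing is lost for `m ≤ 4`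
-- (`consecutive_of_le_four`).
--
-- Columns of `K_m × P_n` are cliques, so membership in `spanning` only asks that neighbouring
-- columns overlap, and the sets to be counted correspond one to one by their older columns.
-- Induction yields `lowerBound_lower`. Finally, a connected set of the grid occupies an interval of
-- `k` columns, which has `n - k + 1` positions (`numConn_PP`).

lemma SameComp.mem_left (h : SameComp G A u v) : u ∈ A := by
  obtain ⟨hu, -, -⟩ := h; exact hu

lemma SameComp.mem_right (h : SameComp G A u v) : v ∈ A := by
  obtain ⟨-, hv, -⟩ := h; exact hv

lemma SameComp.refl (hu : u ∈ A) : SameComp G A u u :=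
  ⟨hu, hu, SimpleGraph.Reachable.refl _⟩

lemma SameComp.symm (h : SameComp G A u v) : SameComp G A v u := by
  obtain ⟨hu, hv, h⟩ := h; exact ⟨hv, hu, h.symm⟩

lemma SameComp.trans (h : SameComp G A u v) (h' : SameComp G A v w) : SameComp G A u w := by
  obtain ⟨hu, hv, h⟩ := h
  obtain ⟨_, hw, h'⟩ := h'
  exact ⟨hu, hw, h.trans h'⟩

lemma SameComp.of_adj (hu : u ∈ A) (hv : v ∈ A) (h : G.Adj u v) : SameComp G A u v :=
  ⟨hu, hv, SimpleGraph.Adj.reachable (by simpa using h)⟩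

lemma SameComp.step (h : SameComp G A u v) (hw : w ∈ A) (hvw : G.Adj v w) : SameComp G A u w :=
  h.trans (.of_adj h.mem_right hw hvw)

/-- To prove a property along a component it is enough to propagate it along edges. -/
lemma SameComp.propagate {p : V → Prop} (h : SameComp G A u v) (h0 : p u)
    (hp : ∀ a b, a ∈ A → b ∈ A → G.Adj a b → SameComp G A u a → p a → p b) : p v := by
  obtain ⟨hu, hv, h⟩ := h
  rw [SimpleGraph.reachable_iff_reflTransGen] at h
  have key : ∀ z : (A : Set V), Relation.ReflTransGen (G.induce (A : Set V)).Adj ⟨u, hu⟩ z →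
      SameComp G A u z ∧ p z := by
    intro z hz
    induction hz with
    | refl => exact ⟨.refl hu, h0⟩
    | @tail b c _ hbc ih =>
      have hadj : G.Adj b c := by simpa using hbc
      exact ⟨ih.1.step c.2 hadj, hp _ _ b.2 c.2 hadj ih.1 ih.2⟩
  exact (key _ h).2

lemma SameComp.mono (hAB : A ⊆ B) (h : SameComp G A u v) : SameComp G B u v :=
  h.propagate (.refl (hAB h.mem_left)) fun _ _ _ hb hab _ ih => ih.step (hAB hb) hab

lemma sameComp_map (f : G ↪g H) :
    SameComp H (A.map f.toEmbedding) (f u) (f v) ↔ SameComp G A u v := by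
  constructor
  · intro h
    have hu : u ∈ A := by simpa using h.mem_left
    obtain ⟨z, hz, h'⟩ := h.propagate (p := fun w => ∃ z, f z = w ∧ SameComp G A u z)
      ⟨u, rfl, .refl hu⟩ (by
        rintro _ b - hb hab - ⟨z, rfl, hz⟩
        obtain ⟨y, hy, rfl⟩ := Finset.mem_map.1 hb
        exact ⟨y, rfl, hz.step hy (f.map_rel_iff.1 hab)⟩)
    rwa [← f.injective hz]
  · intro h
    exact h.propagate (p := fun w => SameComp H (A.map f.toEmbedding) (f u) (f w))
      (.refl (Finset.mem_map_of_mem _ h.mem_left)) fun a b _ hb hab _ ih =>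
        ih.step (Finset.mem_map_of_mem _ hb) (f.map_rel_iff.2 hab)

lemma isConnSet_iff : IsConnSet G A ↔ A.Nonempty ∧ ∀ u ∈ A, ∀ v ∈ A, SameComp G A u v := by
  constructor
  · intro h
    obtain ⟨⟨x, hx⟩⟩ := h.nonempty
    exact ⟨⟨x, hx⟩, fun u hu v hv => ⟨hu, hv, h.preconnected _ _⟩⟩
  · rintro ⟨⟨x, hx⟩, h⟩
    have : Nonempty (A : Set V) := ⟨⟨x, hx⟩⟩
    exact ⟨fun u v => by obtain ⟨_, _, h⟩ := h u u.2 v v.2; exact h⟩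

lemma isConnSet_of_root (hu : u ∈ A) (h : ∀ v ∈ A, SameComp G A u v) : IsConnSet G A :=
  isConnSet_iff.2 ⟨⟨u, hu⟩, fun _ ha _ hb => (h _ ha).symm.trans (h _ hb)⟩

lemma isConnSet_map (f : G ↪g H) : IsConnSet H (A.map f.toEmbedding) ↔ IsConnSet G A := by
  simp only [isConnSet_iff, Finset.map_nonempty, Finset.mem_map, forall_exists_index, and_imp,
    forall_apply_eq_imp_iff₂]
  exact and_congr_right fun _ => forall₄_congr fun a _ b _ => sameComp_map f

lemma IsConnSet.mono_graph {G' : SimpleGraph V} (hG : G ≤ G') (h : IsConnSet G A) :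
    IsConnSet G' A := by
  rw [isConnSet_iff] at h ⊢
  exact ⟨h.1, fun u hu v hv => (h.2 u hu v hv).propagate (.refl hu)
    fun _ _ _ hb hab _ ih => ih.step hb (hG hab)⟩

lemma mem_comps {D : Finset V} :
    D ∈ comps G A ↔ ∃ a ∈ A, ∀ x, x ∈ D ↔ SameComp G A a x := by
  classical
  simp only [comps, Finset.mem_image]
  refine exists_congr fun a => and_congr_right fun _ => ⟨?_, fun h => ?_⟩
  · rintro rfl x
    simp only [Finset.mem_filter]
    exact ⟨fun h => h.2, fun h => ⟨h.mem_right, h⟩⟩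
  · ext x
    simp only [Finset.mem_filter, h]
    exact ⟨fun h => h.2, fun h => ⟨h.mem_right, h⟩⟩

/-- Each component of `G[I]` lies in one of `G[B]`, and this map is onto because every component of
`G[B]` meets `I`. Equal finite cardinalities make it injective, so `B` merges no two components of
`G[I]`. -/
lemma sameComp_of_card_comps_eq {I : Finset V} (hI : I ⊆ B)
    (hB : ∀ b ∈ B, ∃ x ∈ I, SameComp G B b x) (hc : (comps G B).card = (comps G I).card)
    {x y : V} (hx : x ∈ I) (hy : y ∈ I) (h : SameComp G B x y) : SameComp G I x y := by
  classical
  -- `f` sends a component of `G[I]` to the component of `G[B]` around it.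
  let f : Finset V → Finset V := fun D => B.filter fun v => ∃ d ∈ D, SameComp G B d v
  have hf : ∀ a ∈ I, f (I.filter (SameComp G I a)) = B.filter (SameComp G B a) := by
    intro a ha
    ext v
    simp only [f, Finset.mem_filter, and_congr_right_iff]
    intro _
    constructor
    · rintro ⟨d, ⟨-, hd⟩, hdv⟩
      exact (hd.mono hI).trans hdv
    · intro hav
      exact ⟨a, ⟨ha, .refl ha⟩, hav⟩
  have hsurj : comps G B ⊆ (comps G I).image f := by
    intro D hD
    simp only [comps, Finset.mem_image] at hD
    obtain ⟨b, hb, rfl⟩ := hD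
    obtain ⟨a, ha, hba⟩ := hB b hb
    refine Finset.mem_image.2 ⟨_, Finset.mem_image_of_mem _ ha, (hf a ha).trans ?_⟩
    ext v
    simp only [Finset.mem_filter, and_congr_right_iff]
    exact fun _ => ⟨fun h => hba.trans h, fun h => hba.symm.trans h⟩
  have hinj : Set.InjOn f (comps G I) := by
    refine Finset.card_image_iff.1 (le_antisymm Finset.card_image_le ?_)
    rw [← hc]
    exact Finset.card_le_card hsurj
  have heq : I.filter (SameComp G I x) = I.filter (SameComp G I y) := by
    refine hinj (Finset.mem_image_of_mem _ hx) (Finset.mem_image_of_mem _ hy) ?_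
    rw [hf x hx, hf y hy]
    ext v
    simp only [Finset.mem_filter, and_congr_right_iff]
    exact fun _ => ⟨fun h' => h.symm.trans h', fun h' => h.trans h'⟩
  have : y ∈ I.filter (SameComp G I x) := by
    rw [heq]
    exact Finset.mem_filter.2 ⟨hy, .refl hy⟩
  exact (Finset.mem_filter.1 this).2

/-- Every edge of `G[A ∪ B]` lies in `A` or in `B`. -/
def Separates [DecidableEq V] (G : SimpleGraph V) (A B : Finset V) : Prop :=
  ∀ a ∈ A ∪ B, ∀ b ∈ A ∪ B, G.Adj a b → (a ∈ A ∧ b ∈ A) ∨ (a ∈ B ∧ b ∈ B)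

variable [DecidableEq V]

lemma not_isConnSet_union (hs : Separates G A B) (hA : A.Nonempty)
    (hB : ∃ b ∈ B, ∀ x ∈ A, ¬ SameComp G B b x) : ¬ IsConnSet G (A ∪ B) := by
  intro h
  obtain ⟨b, hb, hbx⟩ := hB
  obtain ⟨a, ha⟩ := hA
  have hba := (isConnSet_iff.1 h).2 b (Finset.mem_union_right _ hb) a (Finset.mem_union_left _ ha)
  refine hbx a ha (hba.propagate (.refl hb) fun v w hv hw hvw _ ih => ?_)
  rcases hs v hv w hw hvw with h' | h'
  · exact absurd ih (hbx v h'.1)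
  · exact ih.step h'.2 hvw

/-- A path in `A ∪ B` consists of edges in `A` and excursions through `B` with both ends in `A`;
each excursion can be rerouted through `B'`. -/
lemma IsConnSet.replace {B' : Finset V} (hs : Separates G A B) (hA : A.Nonempty)
    (hB' : ∀ b ∈ B', ∃ x ∈ A, SameComp G B' b x)
    (hBB' : ∀ x ∈ A, ∀ y ∈ A, SameComp G B x y → SameComp G B' x y)
    (h : IsConnSet G (A ∪ B)) : IsConnSet G (A ∪ B') := by
  obtain ⟨a, ha⟩ := hA
  have hA' : ∀ {z}, z ∈ A → z ∈ A ∪ B' := fun h => Finset.mem_union_left _ h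
  have hle : B' ⊆ A ∪ B' := Finset.subset_union_right
  have key : ∀ v ∈ A, SameComp G (A ∪ B') a v := by
    intro v hv
    have hav := (isConnSet_iff.1 h).2 a (Finset.mem_union_left _ ha) v (Finset.mem_union_left _ hv)
    have up : ∀ z ∈ A, (SameComp G (A ∪ B') a z ∨
        ∃ x ∈ A, SameComp G B x z ∧ SameComp G (A ∪ B') a x) → SameComp G (A ∪ B') a z := by
      rintro z hz (h | ⟨x, hx, hxz, hax⟩)
      · exact h
      · exact hax.trans ((hBB' x hx z hz hxz).mono hle)
    -- Invariant along the path: either the current vertex is in `A` and already reached in `A ∪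
    -- B'`, or it is on an excursion through `B` whose starting point `x` is reached. `up` closes an
    -- excursion on its return to `A`.
    refine up v hv (hav.propagate
      (p := fun z => (z ∈ A ∧ SameComp G (A ∪ B') a z) ∨
        ∃ x ∈ A, SameComp G B x z ∧ SameComp G (A ∪ B') a x)
      (Or.inl ⟨ha, .refl (hA' ha)⟩) (fun z w hz hw hzw _ ih => ?_) |>.imp_left And.right)
    rcases hs z hz w hw hzw with h' | h'
    · exact Or.inl ⟨h'.2, (up z h'.1 (ih.imp_left And.right)).step (hA' h'.2) hzw⟩
    · rcases ih with ih | ⟨x, hx, hxz, hax⟩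
      · exact Or.inr ⟨z, ih.1, .of_adj h'.1 h'.2 hzw, ih.2⟩
      · exact Or.inr ⟨x, hx, hxz.step h'.2 hzw, hax⟩
  refine isConnSet_of_root (hA' ha) fun v hv => ?_
  rcases Finset.mem_union.1 hv with hv | hv
  · exact key v hv
  · obtain ⟨x, hx, hvx⟩ := hB' v hv
    exact (key x hx).trans (hvx.symm.mono hle)

lemma isConnSet_union_congr {B' : Finset V} (hs : Separates G A B) (hs' : Separates G A B')
    (hA : A.Nonempty) (hB : ∀ b ∈ B, ∃ x ∈ A, SameComp G B b x)
    (hB' : ∀ b ∈ B', ∃ x ∈ A, SameComp G B' b x)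
    (hBB' : ∀ x ∈ A, ∀ y ∈ A, SameComp G B x y ↔ SameComp G B' x y) :
    IsConnSet G (A ∪ B) ↔ IsConnSet G (A ∪ B') :=
  ⟨.replace hs hA hB' fun x hx y hy => (hBB' x hx y hy).1,
    .replace hs' hA hB fun x hx y hy => (hBB' x hx y hy).2⟩

/-- A component of `G[B]` survives the deletion of `I` exactly when it avoids `I`. This is the form
in which conditions 1 and (i) are used. -/
lemma sharesComp_sdiff_iff {I : Finset V} :
    SharesComp G (B \ I) B ↔ ∃ b ∈ B, ∀ x ∈ I, ¬ SameComp G B b x := by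
  constructor
  · rintro ⟨D, hD, hD'⟩
    obtain ⟨a, ha, haD⟩ := mem_comps.1 hD
    obtain ⟨b, hb, hbD⟩ := mem_comps.1 hD'
    refine ⟨b, hb, fun x hx h => ?_⟩
    have := ((haD x).1 ((hbD x).2 h)).mem_right
    exact (Finset.mem_sdiff.1 this).2 hx
  · classical
    rintro ⟨b, hb, hbI⟩
    have hmem : ∀ {x}, SameComp G B b x → x ∈ B \ I := fun h =>
      Finset.mem_sdiff.2 ⟨h.mem_right, fun hI => hbI _ hI h⟩
    refine ⟨B.filter (SameComp G B b), mem_comps.2 ⟨b, hmem (.refl hb), fun x => ?_⟩,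
      mem_comps.2 ⟨b, hb, fun x => ?_⟩⟩
    · rw [Finset.mem_filter]
      refine ⟨fun h => ?_, fun h => ⟨(Finset.mem_sdiff.1 h.mem_right).1,
        h.mono Finset.sdiff_subset⟩⟩
      exact h.2.propagate (.refl (hmem (.refl hb))) fun z w _ hw hzw hz ih =>
        ih.step (hmem (hz.step hw hzw)) hzw
    · rw [Finset.mem_filter]
      exact ⟨fun h => h.2, fun h => ⟨h.mem_right, h⟩⟩

end SameComp

-- Grids inside one grid with infinitely many columns.

lemma PP_adj {m n : ℕ} {p q : Fin m × Fin n} : (PP m n).Adj p q ↔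
    ((p.1.val + 1 = q.1.val ∨ q.1.val + 1 = p.1.val) ∧ p.2 = q.2) ∨
      ((p.2.val + 1 = q.2.val ∨ q.2.val + 1 = p.2.val) ∧ p.1 = q.1) := by
  simp [PP, SimpleGraph.boxProd_adj, SimpleGraph.pathGraph_adj]

lemma KP_adj {m n : ℕ} {p q : Fin m × Fin n} : (KP m n).Adj p q ↔
    (p.1 ≠ q.1 ∧ p.2 = q.2) ∨
      ((p.2.val + 1 = q.2.val ∨ q.2.val + 1 = p.2.val) ∧ p.1 = q.1) := by
  simp [KP, SimpleGraph.boxProd_adj, SimpleGraph.pathGraph_adj]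

lemma PP_le_KP (m n : ℕ) : PP m n ≤ KP m n := by
  intro p q
  rw [PP_adj, KP_adj]
  rintro (⟨h, h'⟩ | h)
  · exact Or.inl ⟨fun e => by rw [e] at h; omega, h'⟩
  · exact Or.inr h

/-- The grid with `m` rows and infinitely many columns. -/
def grid (m : ℕ) : SimpleGraph (Fin m × ℕ) :=
  SimpleGraph.boxProd (SimpleGraph.pathGraph m) (SimpleGraph.hasse ℕ)

lemma grid_adj {m : ℕ} {p q : Fin m × ℕ} : (grid m).Adj p q ↔
    ((p.1.val + 1 = q.1.val ∨ q.1.val + 1 = p.1.val) ∧ p.2 = q.2) ∨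
      ((p.2 + 1 = q.2 ∨ q.2 + 1 = p.2) ∧ p.1 = q.1) := by
  simp [grid, SimpleGraph.boxProd_adj, SimpleGraph.pathGraph_adj, SimpleGraph.hasse_adj,
    Nat.covBy_iff_add_one_eq]

/-- The copy of `P_m × P_n` in the columns `k, …, k + n - 1` of the grid. -/
def shift (m n k : ℕ) : PP m n ↪g grid m where
  toFun p := (p.1, p.2.val + k)
  inj' p q h := by
    simp only [Prod.mk.injEq, Nat.add_right_cancel_iff] at h
    exact Prod.ext h.1 (Fin.ext h.2)
  map_rel_iff' := by
    intro p q
    rw [PP_adj]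
    change (grid m).Adj (p.1, p.2.val + k) (q.1, q.2.val + k) ↔ _
    simp only [grid_adj, Fin.ext_iff]
    omega

/-- The set `C`, moved to the columns `k, k + 1, …` of the grid. -/
def place {m n : ℕ} (k : ℕ) (C : Finset (Fin m × Fin n)) : Finset (Fin m × ℕ) :=
  C.map (shift m n k).toEmbedding

lemma isConnSet_place {m n : ℕ} (k : ℕ) {C : Finset (Fin m × Fin n)} :
    IsConnSet (grid m) (place k C) ↔ IsConnSet (PP m n) C :=
  isConnSet_map _

lemma mem_place {m n k : ℕ} {C : Finset (Fin m × Fin n)} {i : Fin m} {j : ℕ} :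
    (i, j) ∈ place k C ↔ ∃ l : Fin n, (i, l) ∈ C ∧ l.val + k = j := by
  simp only [place, Finset.mem_map, Prod.exists]
  constructor
  · rintro ⟨a, l, h, h'⟩
    obtain ⟨rfl, rfl⟩ := Prod.mk.inj h'
    exact ⟨l, h, rfl⟩
  · rintro ⟨l, h, rfl⟩
    exact ⟨i, l, h, rfl⟩

lemma separates_of_column {m c : ℕ} {A B : Finset (Fin m × ℕ)} (hA : ∀ p ∈ A, p.2 ≤ c)
    (hB : ∀ p ∈ B, c ≤ p.2) (hAB : ∀ p : Fin m × ℕ, p.2 = c → (p ∈ A ↔ p ∈ B)) :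
    Separates (grid m) A B := by
  intro p hp q hq hpq
  have hpq' : p.2 ≤ q.2 + 1 ∧ q.2 ≤ p.2 + 1 := by
    rw [grid_adj] at hpq; omega
  have mA : ∀ z ∈ A ∪ B, z.2 ≤ c → z ∈ A := fun z hz hzc => by
    rcases Finset.mem_union.1 hz with h | h
    · exact h
    · exact (hAB z (le_antisymm hzc (hB z h))).2 h
  have mB : ∀ z ∈ A ∪ B, c ≤ z.2 → z ∈ B := fun z hz hzc => by
    rcases Finset.mem_union.1 hz with h | h
    · exact (hAB z (le_antisymm (hA z h) hzc)).1 h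
    · exact h
  by_cases h : p.2 ≤ c ∧ q.2 ≤ c
  · exact Or.inl ⟨mA p hp h.1, mA q hq h.2⟩
  · exact Or.inr ⟨mB p hp (by omega), mB q hq (by omega)⟩

/-- The set `D` with the rows `S` added in a new last column. -/
def snocCol {m n : ℕ} (D : Finset (Fin m × Fin n)) (S : Finset (Fin m)) :
    Finset (Fin m × Fin (n + 1)) :=
  Finset.univ.filter fun p =>
    (p.2 = Fin.last n ∧ p.1 ∈ S) ∨ ∃ l : Fin n, l.castSucc = p.2 ∧ (p.1, l) ∈ D

-- Splitting off the last columns as a window.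

section snocCol

variable {m n : ℕ} {D : Finset (Fin m × Fin n)} {S T X : Finset (Fin m)} {i : Fin m}

@[simp] lemma mem_snocCol_last : (i, Fin.last n) ∈ snocCol D S ↔ i ∈ S := by
  simp [snocCol, Fin.castSucc_ne_last]

@[simp] lemma mem_snocCol_castSucc {l : Fin n} : (i, l.castSucc) ∈ snocCol D S ↔ (i, l) ∈ D := by
  simp [snocCol, Fin.castSucc_ne_last]

lemma lt_of_mem_place {k j : ℕ} (h : (i, j) ∈ place k D) : j < n + k := by
  obtain ⟨l, -, rfl⟩ := mem_place.1 h
  omega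

lemma mem_place_snocCol {j : ℕ} :
    (i, j) ∈ place 0 (snocCol D S) ↔ (j = n ∧ i ∈ S) ∨ (i, j) ∈ place 0 D := by
  simp only [mem_place, Nat.add_zero]
  constructor
  · rintro ⟨l, h, rfl⟩
    induction l using Fin.lastCases with
    | last => exact Or.inl ⟨by simp, by simpa using h⟩
    | cast l => exact Or.inr ⟨l, by simpa using h, by simp⟩
  · rintro (⟨rfl, h⟩ | ⟨l, h, rfl⟩)
    · exact ⟨Fin.last _, by simpa using h, by simp⟩
    · exact ⟨l.castSucc, by simpa using h, by simp⟩

lemma mem_place_wX {k j : ℕ} : (i, j) ∈ place k (wX X) ↔ j = k ∧ i ∈ X := by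
  simp [mem_place, wX, col, eq_comm, and_comm]

lemma mem_place_wT {k j : ℕ} : (i, j) ∈ place k (wT T) ↔ j = k + 1 ∧ i ∈ T := by
  simp [mem_place, wT, col, eq_comm, and_comm, add_comm]

lemma mem_place_wS {k j : ℕ} : (i, j) ∈ place k (wS S) ↔ j = k + 2 ∧ i ∈ S := by
  simp [mem_place, wS, col, eq_comm, and_comm, add_comm]

lemma place_union {k : ℕ} {C C' : Finset (Fin m × Fin n)} :
    place k (C ∪ C') = place k C ∪ place k C' :=
  Finset.map_union _ _

lemma mem_place_wST {k j : ℕ} :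
    (i, j) ∈ place k (wST S T) ↔ (j = k + 2 ∧ i ∈ S) ∨ (j = k + 1 ∧ i ∈ T) := by
  rw [wST, place_union, Finset.mem_union, mem_place_wS, mem_place_wT]

lemma mem_place_wSTX {k j : ℕ} : (i, j) ∈ place k (wSTX S T X) ↔
    ((j = k + 2 ∧ i ∈ S) ∨ (j = k + 1 ∧ i ∈ T)) ∨ (j = k ∧ i ∈ X) := by
  rw [wSTX, place_union, place_union, Finset.mem_union, Finset.mem_union, mem_place_wS,
    mem_place_wT, mem_place_wX]

lemma wST_sdiff : wST S T \ wT T = wS S := by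
  ext ⟨i, j⟩
  fin_cases j <;> simp [wST, wS, wT, col]

lemma wSTX_sdiff : wSTX S T X \ wX X = wST S T := by
  ext ⟨i, j⟩
  fin_cases j <;> simp [wSTX, wST, wX, wS, wT, col]

lemma place_snocCol_wST : place 0 (snocCol (snocCol (snocCol D X) T) S) =
    place 0 (snocCol (snocCol D X) T) ∪ place n (wST S T) := by
  ext ⟨i, j⟩
  simp only [Finset.mem_union, mem_place_snocCol, mem_place_wST]
  tauto

lemma place_snocCol_wSTX : place 0 (snocCol (snocCol (snocCol D X) T) S) =
    place 0 (snocCol D X) ∪ place n (wSTX S T X) := by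
  ext ⟨i, j⟩
  simp only [Finset.mem_union, mem_place_snocCol, mem_place_wSTX]
  tauto

/-- Leaving the third column empty turns a two-column end into a window of the same shape,
comparable with the original one. -/
lemma place_snocCol_two : place 0 (snocCol (snocCol D X) T) =
    place 0 (snocCol D X) ∪ place n (wSTX ∅ T X) := by
  ext ⟨i, j⟩
  simp only [Finset.mem_union, mem_place_snocCol, mem_place_wSTX, Finset.notMem_empty]
  tauto

lemma inter_place_wST :
    place 0 (snocCol (snocCol D X) T) ∩ place n (wST S T) = place n (wT T) := by
  ext ⟨i, j⟩
  simp only [Finset.mem_inter, mem_place_snocCol, mem_place_wST, mem_place_wT]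
  have := @lt_of_mem_place m n D i 0 j
  grind

lemma inter_place_wSTX :
    place 0 (snocCol D X) ∩ place n (wSTX S T X) = place n (wX X) := by
  ext ⟨i, j⟩
  simp only [Finset.mem_inter, mem_place_snocCol, mem_place_wSTX, mem_place_wX]
  have := @lt_of_mem_place m n D i 0 j
  grind

lemma separates_wST :
    Separates (grid m) (place 0 (snocCol (snocCol D X) T)) (place n (wST S T)) := by
  apply separates_of_column (c := n + 1)
  · rintro ⟨i, j⟩ h
    exact Nat.le_of_lt_succ (lt_of_mem_place h)
  · rintro ⟨i, j⟩ h
    rw [mem_place_wST] at h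
    dsimp only; omega
  · rintro ⟨i, j⟩ rfl
    rw [mem_place_snocCol, mem_place_wST]
    have := @lt_of_mem_place m (n + 1) (snocCol D X) i 0 (n + 1)
    grind

lemma separates_wSTX :
    Separates (grid m) (place 0 (snocCol D X)) (place n (wSTX S T X)) := by
  apply separates_of_column (c := n)
  · rintro ⟨i, j⟩ h
    exact Nat.le_of_lt_succ (lt_of_mem_place h)
  · rintro ⟨i, j⟩ h
    rw [mem_place_wSTX] at h
    dsimp only; omega
  · rintro ⟨i, j⟩ rfl
    rw [mem_place_snocCol, mem_place_wSTX]
    have := @lt_of_mem_place m j D i 0 j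
    grind

lemma place_snocCol_nonempty (hS : S.Nonempty) : (place 0 (snocCol D S)).Nonempty := by
  obtain ⟨i, hi⟩ := hS
  exact ⟨(i, n), mem_place_snocCol.2 (Or.inl ⟨rfl, hi⟩)⟩

end snocCol

-- The gluing criteria for windows.

section glue

variable {m k : ℕ} {A : Finset (Fin m × ℕ)} {B I : Finset (Fin m × Fin 3)}

lemma exists_sameComp_place (hAB : A ∩ place k B = place k I)
    (hs : ¬ SharesComp (PP m 3) (B \ I) B) :
    ∀ b ∈ place k B, ∃ x ∈ A, SameComp (grid m) (place k B) b x := by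
  intro b hb
  obtain ⟨b, hbB, rfl⟩ := Finset.mem_map.1 hb
  rw [sharesComp_sdiff_iff] at hs
  push Not at hs
  obtain ⟨x, hx, hbx⟩ := hs b hbB
  refine ⟨shift m 3 k x, ?_, (sameComp_map _).2 hbx⟩
  have : shift m 3 k x ∈ A ∩ place k B := hAB ▸ Finset.mem_map_of_mem _ hx
  exact (Finset.mem_inter.1 this).1

lemma exists_shift_of_mem (hAB : A ∩ place k B = place k I) {x : Fin m × ℕ} (hx : x ∈ A)
    (hxB : x ∈ place k B) : ∃ y ∈ I, shift m 3 k y = x := by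
  have : x ∈ place k I := hAB ▸ Finset.mem_inter.2 ⟨hx, hxB⟩
  exact Finset.mem_map.1 this

lemma not_isConnSet_of_sharesComp (hsep : Separates (grid m) A (place k B))
    (hAB : A ∩ place k B = place k I) (hA : A.Nonempty) (hs : SharesComp (PP m 3) (B \ I) B) :
    ¬ IsConnSet (grid m) (A ∪ place k B) := by
  obtain ⟨b, hb, hbI⟩ := sharesComp_sdiff_iff.1 hs
  refine not_isConnSet_union hsep hA ⟨_, Finset.mem_map_of_mem _ hb, fun x hx h => ?_⟩
  obtain ⟨y, hy, rfl⟩ := exists_shift_of_mem hAB hx h.mem_right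
  exact hbI y hy ((sameComp_map _).1 h)

/-- The window is exchanged for its intersection with `A`, which adds nothing to `A`. -/
lemma isConnSet_iff_of_card_comps_eq (hsep : Separates (grid m) A (place k B))
    (hAB : A ∩ place k B = place k I) (hI : I ⊆ B) (hA : A.Nonempty)
    (hs : ¬ SharesComp (PP m 3) (B \ I) B)
    (hc : (comps (PP m 3) B).card = (comps (PP m 3) I).card) :
    IsConnSet (grid m) (A ∪ place k B) ↔ IsConnSet (grid m) A := by
  have hIA : place k I ⊆ A := hAB ▸ Finset.inter_subset_left
  have hsI : Separates (grid m) A (place k I) := by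
    intro a ha b hb _
    rw [Finset.union_eq_left.2 hIA] at ha hb
    exact Or.inl ⟨ha, hb⟩
  have hs' := hs
  rw [sharesComp_sdiff_iff] at hs'
  push Not at hs'
  have := isConnSet_union_congr hsep hsI hA (exists_sameComp_place hAB hs)
    (fun b hb => ⟨b, hIA hb, .refl hb⟩) (fun x hx y hy => ⟨fun h => ?_, fun h => ?_⟩)
  · rwa [Finset.union_eq_left.2 hIA] at this
  · obtain ⟨x, hxI, rfl⟩ := exists_shift_of_mem hAB hx h.mem_left
    obtain ⟨y, hyI, rfl⟩ := exists_shift_of_mem hAB hy h.mem_right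
    exact (sameComp_map _).2
      (sameComp_of_card_comps_eq hI hs' hc hxI hyI ((sameComp_map _).1 h))
  · exact h.mono (Finset.map_subset_map.2 hI)

end glue

-- Replacing a window by a column of intervals.

section fill

variable {m : ℕ} {S T X : Finset (Fin m)}

lemma mem_rowsOf {x q : Fin m} :
    q ∈ rowsOf S T X x ↔ SameComp (PP m 3) (wSTX S T X) (x, 0) (q, 0) := by
  simp [rowsOf]

@[simp] lemma mem_wSTX_zero {q : Fin m} : (q, (0 : Fin 3)) ∈ wSTX S T X ↔ q ∈ X := by
  simp [wSTX, wS, wT, wX, col]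

@[simp] lemma mem_wSTX_one {q : Fin m} : (q, (1 : Fin 3)) ∈ wSTX S T X ↔ q ∈ T := by
  simp [wSTX, wS, wT, wX, col]

@[simp] lemma mem_wSTX_two {q : Fin m} : (q, (2 : Fin 3)) ∈ wSTX S T X ↔ q ∈ S := by
  simp [wSTX, wS, wT, wX, col]

lemma rowsOf_eq {x y : Fin m} (h : SameComp (PP m 3) (wSTX S T X) (x, 0) (y, 0)) :
    rowsOf S T X x = rowsOf S T X y := by
  ext q
  rw [mem_rowsOf, mem_rowsOf]
  exact ⟨h.symm.trans, h.trans⟩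

/-- The smallest row of a component in the column of `X` identifies the component, so conditions on
`low` are conditions on the partition of `X`. -/
lemma sameComp_iff_low_eq {x y : Fin m} (hx : x ∈ X) :
    SameComp (PP m 3) (wSTX S T X) (x, 0) (y, 0) ↔ low S T X x = low S T X y := by
  constructor
  · intro h
    rw [low, low, rowsOf_eq h]
  · intro h
    have hxx : x ∈ rowsOf S T X x := mem_rowsOf.2 (.refl (by simpa using hx))
    obtain ⟨q, hq⟩ := Finset.min_of_mem hxx
    have h1 := mem_rowsOf.1 (Finset.mem_of_min hq)
    have h2 := mem_rowsOf.1 (Finset.mem_of_min ((show (rowsOf S T X y).min = _ from h.symm).trans hq))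
    exact h1.trans h2.symm

lemma mem_fill {j : Fin m} : j ∈ fill S T X ↔ ∃ x ∈ X, ∃ a ∈ rowsOf S T X x,
    ∃ b ∈ rowsOf S T X x, a ≤ j ∧ j ≤ b := by
  simp only [fill, Finset.mem_filter, Finset.mem_univ, true_and]
  refine exists_congr fun x => and_congr_right fun hx => ?_
  have hxx : x ∈ rowsOf S T X x := mem_rowsOf.2 (.refl (by simpa using hx))
  obtain ⟨p, hp⟩ := Finset.min_of_mem hxx
  obtain ⟨q, hq⟩ := Finset.max_of_mem hxx
  rw [low, high, hp, hq, WithTop.coe_le_coe, WithBot.coe_le_coe]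
  constructor
  · rintro ⟨h1, h2⟩
    exact ⟨p, Finset.mem_of_min hp, q, Finset.mem_of_max hq, h1, h2⟩
  · rintro ⟨a, ha, b, hb, h1, h2⟩
    exact ⟨(Finset.min_le_of_eq ha hp).trans h1, h2.trans (Finset.le_max_of_eq hb hq)⟩

lemma subset_fill : X ⊆ fill S T X := fun x hx => by
  have hxx : x ∈ rowsOf S T X x := mem_rowsOf.2 (.refl (by simpa using hx))
  exact mem_fill.2 ⟨x, hx, x, hxx, x, hxx, le_rfl, le_rfl⟩

lemma Consecutive.sameComp (hc : Consecutive S T X) {x y z : Fin m} (hz : z ∈ X)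
    (h : SameComp (PP m 3) (wSTX S T X) (x, 0) (y, 0)) (hxz : x ≤ z) (hzy : z ≤ y) :
    SameComp (PP m 3) (wSTX S T X) (x, 0) (z, 0) := by
  have hx : x ∈ X := by simpa using h.mem_left
  have hy : y ∈ X := by simpa using h.mem_right
  rw [sameComp_iff_low_eq hx] at h ⊢
  exact ((hc x hx y hy (hxz.trans hzy)).1 h z hz hxz hzy).symm

lemma sameComp_succ {x y : Fin m} (hx : x ∈ X) (hy : y ∈ X)
    (h : x.val + 1 = y.val ∨ y.val + 1 = x.val) :
    SameComp (PP m 3) (wSTX S T X) (x, 0) (y, 0) :=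
  .of_adj (by simpa using hx) (by simpa using hy) (PP_adj.2 (Or.inl ⟨h, rfl⟩))

/-- A row of `X` strictly between `x` and `y` but in another component is adjacent to neither, which
would force `x + 4 ≤ y`. -/
lemma consecutive_of_le_four (hm : m ≤ 4) : Consecutive S T X := by
  intro x hx y hy hxy
  refine ⟨fun h z hz hxz hzy => ?_, fun h => (h y hy hxy le_rfl).symm⟩
  rw [Fin.le_def] at hxz hzy
  by_cases h1 : x = z
  · rw [h1]
  by_cases h2 : z = y
  · rw [h2, h]
  rw [Fin.ext_iff] at h1 h2
  by_cases h3 : x.val + 1 = z.val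
  · exact ((sameComp_iff_low_eq hx).1 (sameComp_succ hx hz (Or.inl h3))).symm
  · rw [h]
    exact (sameComp_iff_low_eq hz).1 (sameComp_succ hz hy (Or.inl (by omega)))

/-- An interval of rows of the column `1` lies in one component. -/
lemma sameComp_interval {F : Finset (Fin m)} {a b : Fin m} (hab : a ≤ b)
    (hF : ∀ j, a ≤ j → j ≤ b → j ∈ F) :
    SameComp (PP m 3) (wSTX S F X) (a, 1) (b, 1) := by
  have key : ∀ d (b : Fin m), b.val = a.val + d → (∀ j, a ≤ j → j ≤ b → j ∈ F) →
      SameComp (PP m 3) (wSTX S F X) (a, 1) (b, 1) := by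
    intro d
    induction d with
    | zero =>
      intro b hb hF
      obtain rfl : b = a := Fin.ext (by omega)
      exact .refl (by simpa using hF b le_rfl le_rfl)
    | succ d ih =>
      intro b hb hF
      have hlt : a.val + d < m := by omega
      refine (ih ⟨a.val + d, hlt⟩ rfl fun j h1 h2 => hF j h1 ?_).step
        (by simpa using hF b (by rw [Fin.le_def]; omega) le_rfl) (PP_adj.2 (Or.inl ⟨?_, rfl⟩))
      · rw [Fin.le_def] at h2 ⊢
        simp only at h2; omega
      · left; simp only; omega
  exact key (b.val - a.val) b (by rw [Fin.le_def] at hab; omega) hF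

lemma sameComp_fill_of_sameComp {x y : Fin m}
    (h : SameComp (PP m 3) (wSTX S T X) (x, 0) (y, 0)) :
    SameComp (PP m 3) (wSTX ∅ (fill S T X) X) (x, 0) (y, 0) := by
  wlog hxy : x ≤ y generalizing x y
  · exact (this h.symm (le_of_not_ge hxy)).symm
  have hx : x ∈ X := by simpa using h.mem_left
  have hy : y ∈ X := by simpa using h.mem_right
  have hv : ∀ z ∈ X, SameComp (PP m 3) (wSTX ∅ (fill S T X) X) (z, 0) (z, 1) := fun z hz =>
    .of_adj (by simpa using hz) (by simpa using subset_fill hz)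
      (PP_adj.2 (Or.inr ⟨by simp, rfl⟩))
  refine ((hv x hx).trans (sameComp_interval hxy fun j h1 h2 => ?_)).trans (hv y hy).symm
  exact mem_fill.2 ⟨x, hx, x, mem_rowsOf.2 (.refl (by simpa using hx)), y, mem_rowsOf.2 h, h1, h2⟩

lemma Consecutive.sameComp_of_sameComp_fill (hc : Consecutive S T X) {x y : Fin m}
    (h : SameComp (PP m 3) (wSTX ∅ (fill S T X) X) (x, 0) (y, 0)) :
    SameComp (PP m 3) (wSTX S T X) (x, 0) (y, 0) := by
  have hx : x ∈ X := by simpa using h.mem_left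
  have hy : y ∈ X := by simpa using h.mem_right
  have hxx : SameComp (PP m 3) (wSTX S T X) (x, 0) (x, 0) := .refl (by simpa using hx)
  -- Invariant: the row of the current vertex lies between two rows of the original component of
  -- `x`. At the end `Consecutive` puts `y` itself in that component.
  have key := h.propagate (p := fun v => ∃ a b : Fin m,
      SameComp (PP m 3) (wSTX S T X) (x, 0) (a, 0) ∧
      SameComp (PP m 3) (wSTX S T X) (x, 0) (b, 0) ∧ a ≤ v.1 ∧ v.1 ≤ b)
    ⟨x, x, hxx, hxx, le_rfl, le_rfl⟩ ?_
  · obtain ⟨a, b, ha, hb, h1, h2⟩ := key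
    exact ha.trans (hc.sameComp hy (ha.symm.trans hb) h1 h2)
  rintro ⟨i, c⟩ ⟨j, d⟩ - hjd hadj - ⟨a, b, ha, hb, h1, h2⟩
  rcases PP_adj.1 hadj with ⟨hij, -⟩ | ⟨-, hij⟩
  swap
  · obtain rfl : i = j := hij
    exact ⟨a, b, ha, hb, h1, h2⟩
  simp only at hij h1 h2
  have hjF : j ∈ fill S T X := by
    fin_cases d
    · exact subset_fill (by simpa using hjd)
    · simpa using hjd
    · simp at hjd
  -- If `j` leaves `[a, b]`, it does so by one row. The interval `[p, q]` spanned by one component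
  -- then either contains the end just left, so that `Consecutive` identifies the components, or
  -- begins in the row next to that end, and adjacency does.
  obtain ⟨z, -, p, hp, q, hq, hpj, hjq⟩ := mem_fill.1 hjF
  have hpq := (mem_rowsOf.1 hp).symm.trans (mem_rowsOf.1 hq)
  have haX : a ∈ X := by simpa using ha.mem_right
  have hbX : b ∈ X := by simpa using hb.mem_right
  have hpX : p ∈ X := by simpa using hpq.mem_left
  have hqX : q ∈ X := by simpa using hpq.mem_right
  by_cases hja : a ≤ j
  · by_cases hjb : j ≤ b
    · exact ⟨a, b, ha, hb, hja, hjb⟩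
    · refine ⟨a, q, ha, ?_, hja, hjq⟩
      by_cases hpb : p ≤ b
      · exact hb.trans ((hc.sameComp hbX hpq hpb (by
          rw [Fin.le_def] at *; omega)).symm.trans hpq)
      · exact (hb.trans (sameComp_succ hbX hpX (by rw [Fin.le_def] at *; omega))).trans hpq
  · refine ⟨p, b, ?_, hb, hpj, by dsimp only; rw [Fin.le_def] at *; omega⟩
    by_cases haq : a ≤ q
    · exact ha.trans (hc.sameComp haX hpq (by rw [Fin.le_def] at *; omega) haq).symm
    · exact (ha.trans (sameComp_succ haX hqX (by rw [Fin.le_def] at *; omega))).trans hpq.symm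

variable {n : ℕ} {D : Finset (Fin m × Fin n)}

lemma isConnSet_fill_iff (hX : X.Nonempty) (hs : ¬ SharesComp (PP m 3) (wST S T) (wSTX S T X))
    (hc : Consecutive S T X) :
    IsConnSet (PP m (n + 3)) (snocCol (snocCol (snocCol D X) T) S) ↔
      IsConnSet (PP m (n + 2)) (snocCol (snocCol D X) (fill S T X)) := by
  rw [← isConnSet_place 0, ← isConnSet_place 0, place_snocCol_wSTX, place_snocCol_two]
  refine isConnSet_union_congr separates_wSTX separates_wSTX (place_snocCol_nonempty hX)
    (exists_sameComp_place (I := wX X) inter_place_wSTX (by rwa [wSTX_sdiff]))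
    (exists_sameComp_place (I := wX X) inter_place_wSTX ?_) (fun x hx y hy => ?_)
  · rw [sharesComp_sdiff_iff]
    push Not
    rintro ⟨i, j⟩ hij
    have hz : ∀ z ∈ X, ((z, 0) : Fin m × Fin 3) ∈ wX X := fun z hz => by simpa [wX, col] using hz
    fin_cases j
    · exact ⟨(i, 0), hz i (by simpa using hij), .refl hij⟩
    · obtain ⟨z, hzX, p, hp, q, hq, hpi, hiq⟩ := mem_fill.1 (by simpa using hij)
      have hpX : p ∈ X := by simpa using (mem_rowsOf.1 hp).mem_right
      refine ⟨(p, 0), hz p hpX, SameComp.symm (SameComp.trans (v := (p, 1)) (.of_adj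
        (by simpa using hpX) (by simpa using subset_fill hpX) (PP_adj.2 (Or.inr ⟨by simp, rfl⟩)))
        (sameComp_interval hpi fun j h1 h2 => ?_))⟩
      exact mem_fill.2 ⟨z, hzX, p, hp, q, hq, h1, h2.trans hiq⟩
    · simp at hij
  · have conv : ∀ {S T : Finset (Fin m)} {z : Fin m × ℕ}, z ∈ place 0 (snocCol D X) →
        z ∈ place n (wSTX S T X) → ∃ i, shift m 3 n (i, 0) = z := fun h h' => by
      obtain ⟨⟨i, j⟩, hi, rfl⟩ := exists_shift_of_mem (I := wX X) inter_place_wSTX h h'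
      obtain rfl : j = 0 := by simpa [wX, col] using (Finset.mem_product.1 hi).2
      exact ⟨i, rfl⟩
    constructor
    · intro h
      obtain ⟨i, rfl⟩ := conv hx h.mem_left
      obtain ⟨j, rfl⟩ := conv hy h.mem_right
      exact (sameComp_map _).2 (sameComp_fill_of_sameComp ((sameComp_map _).1 h))
    · intro h
      obtain ⟨i, rfl⟩ := conv hx h.mem_left
      obtain ⟨j, rfl⟩ := conv hy h.mem_right
      exact (sameComp_map _).2 (hc.sameComp_of_sameComp_fill ((sameComp_map _).1 h))

lemma isConnSet_wSTX_iff (hX : X.Nonempty)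
    (hs : ¬ SharesComp (PP m 3) (wST S T) (wSTX S T X))
    (hc : (comps (PP m 3) (wSTX S T X)).card = (comps (PP m 3) (wX X)).card) :
    IsConnSet (PP m (n + 3)) (snocCol (snocCol (snocCol D X) T) S) ↔
      IsConnSet (PP m (n + 1)) (snocCol D X) := by
  rw [← isConnSet_place 0, ← isConnSet_place 0, place_snocCol_wSTX]
  exact isConnSet_iff_of_card_comps_eq separates_wSTX inter_place_wSTX
    Finset.subset_union_right (place_snocCol_nonempty hX) (by rwa [wSTX_sdiff]) hc

lemma not_isConnSet_wSTX (hX : X.Nonempty)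
    (hs : SharesComp (PP m 3) (wST S T) (wSTX S T X)) :
    ¬ IsConnSet (PP m (n + 3)) (snocCol (snocCol (snocCol D X) T) S) := by
  rw [← isConnSet_place 0, place_snocCol_wSTX]
  exact not_isConnSet_of_sharesComp separates_wSTX (I := wX X) inter_place_wSTX
    (place_snocCol_nonempty hX) (by rwa [wSTX_sdiff])

lemma isConnSet_wST_iff (hT : T.Nonempty) (hs : ¬ SharesComp (PP m 3) (wS S) (wST S T))
    (hc : (comps (PP m 3) (wST S T)).card = (comps (PP m 3) (wT T)).card) :
    IsConnSet (PP m (n + 3)) (snocCol (snocCol (snocCol D X) T) S) ↔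
      IsConnSet (PP m (n + 2)) (snocCol (snocCol D X) T) := by
  rw [← isConnSet_place 0, ← isConnSet_place 0, place_snocCol_wST]
  exact isConnSet_iff_of_card_comps_eq separates_wST inter_place_wST
    Finset.subset_union_right (place_snocCol_nonempty hT) (by rwa [wST_sdiff]) hc

lemma not_isConnSet_wST (hT : T.Nonempty) (hs : SharesComp (PP m 3) (wS S) (wST S T)) :
    ¬ IsConnSet (PP m (n + 3)) (snocCol (snocCol (snocCol D X) T) S) := by
  rw [← isConnSet_place 0, place_snocCol_wST]
  exact not_isConnSet_of_sharesComp separates_wST (I := wT T) inter_place_wST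
    (place_snocCol_nonempty hT) (by rwa [wST_sdiff])

end fill

-- Connected sets of `K_m × P_n` column by column.

section spanning

variable {m n : ℕ}

lemma mem_spanning {C : Finset (Fin m × Fin n)} :
    C ∈ spanning m n ↔ IsConnSet (KP m n) C ∧ ∀ j, ∃ i, (i, j) ∈ C := by
  simp [spanning]

lemma mem_spanning' {C : Finset (Fin m × Fin n)} :
    C ∈ spanning' m n ↔ C ∈ spanning m n ∧ ¬ IsConnSet (PP m n) C := by
  simp [spanning']

lemma isConnSet_KP_snocCol {D : Finset (Fin m × Fin (n + 1))} {S : Finset (Fin m)}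
    (hS : S.Nonempty) (hD : D.Nonempty) :
    IsConnSet (KP m (n + 2)) (snocCol D S) ↔
      IsConnSet (KP m (n + 1)) D ∧ ∃ i ∈ S, (i, Fin.last n) ∈ D := by
  have cross : ∀ {i j : Fin m} {l : Fin (n + 1)},
      (KP m (n + 2)).Adj (i, l.castSucc) (j, Fin.last (n + 1)) → i = j ∧ l = Fin.last n := by
    intro i j l h
    rw [KP_adj] at h
    simp only [Fin.castSucc_ne_last, and_false, false_or, Fin.val_castSucc, Fin.val_last] at h
    exact ⟨h.2, Fin.ext (by simp only [Fin.val_last]; omega)⟩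
  have lift : ∀ {i j : Fin m} {k l : Fin (n + 1)},
      (KP m (n + 2)).Adj (i, k.castSucc) (j, l.castSucc) ↔ (KP m (n + 1)).Adj (i, k) (j, l) := by
    intro i j k l
    simp [KP_adj]
  constructor
  · intro h
    have hC := (isConnSet_iff.1 h).2
    obtain ⟨i0, hi0, hi0D⟩ : ∃ i ∈ S, (i, Fin.last n) ∈ D := by
      by_contra! hno
      obtain ⟨s, hs⟩ := hS
      obtain ⟨⟨i, l⟩, hd⟩ := hD
      have := (hC (i, l.castSucc) (by simpa using hd) (s, Fin.last _) (by simpa using hs)).propagate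
        (p := fun v => v.2 ≠ Fin.last _) (Fin.castSucc_ne_last _) (by
          rintro ⟨a, k⟩ ⟨b, k'⟩ ha hb hab - hk rfl
          induction k using Fin.lastCases with
          | last => exact hk rfl
          | cast k =>
            obtain ⟨rfl, rfl⟩ := cross hab
            exact hno a (by simpa using hb) (by simpa using ha))
      exact this rfl
    refine ⟨isConnSet_of_root hi0D ?_, i0, hi0, hi0D⟩
    rintro ⟨i, l⟩ hv
    have near : ∀ {i}, (i, Fin.last n) ∈ D →
        SameComp (KP m (n + 1)) D (i0, Fin.last n) (i, Fin.last n) := by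
      intro i hi
      by_cases he : i0 = i
      · exact he ▸ .refl hi0D
      · exact .of_adj hi0D hi (KP_adj.2 (Or.inl ⟨he, rfl⟩))
    -- The invariant is vacuous in the new column. A path returning from there lands in the last
    -- column of `D`, a clique containing `i0`.
    refine (hC (i0, (Fin.last n).castSucc) (by simpa using hi0D) (i, l.castSucc)
      (by simpa using hv)).propagate
      (p := fun v => ∀ i l, v = (i, Fin.castSucc l) →
        SameComp (KP m (n + 1)) D (i0, Fin.last n) (i, l)) ?_ ?_ i l rfl
    · intro i l h
      obtain ⟨rfl, hl⟩ := Prod.mk.inj h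
      obtain rfl := Fin.castSucc_injective _ hl
      exact .refl hi0D
    · rintro ⟨a, k⟩ _ - hb hab - ih i l rfl
      have hil : (i, l) ∈ D := by simpa using hb
      induction k using Fin.lastCases with
      | last =>
        obtain ⟨rfl, rfl⟩ := cross hab.symm
        exact near hil
      | cast k => exact (ih a k rfl).step hil (lift.1 hab)
  · rintro ⟨hD', i0, hi0, hi0D⟩
    refine isConnSet_of_root (u := (i0, Fin.last _)) (by simpa using hi0) ?_
    rintro ⟨i, l⟩ hv
    induction l using Fin.lastCases with
    | last =>
      by_cases he : i0 = i
      · exact he ▸ .refl (by simpa using hi0)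
      · exact .of_adj (by simpa using hi0) hv (KP_adj.2 (Or.inl ⟨he, rfl⟩))
    | cast l =>
      refine SameComp.trans (v := (i0, (Fin.last n).castSucc)) (.of_adj (by simpa using hi0)
        (by simpa using hi0D) (KP_adj.2 (Or.inr ⟨by simp, rfl⟩))) ?_
      exact ((isConnSet_iff.1 hD').2 _ hi0D (i, l) (by simpa using hv)).propagate
        (p := fun v => SameComp (KP m (n + 2)) (snocCol D S) (i0, (Fin.last n).castSucc)
          (v.1, v.2.castSucc)) (.refl (by simpa using hi0D))
        fun a b _ hb hab _ ih => ih.step (by simpa using hb) (lift.2 hab)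

lemma snocCol_mem_spanning {D : Finset (Fin m × Fin (n + 1))} {S : Finset (Fin m)} :
    snocCol D S ∈ spanning m (n + 2) ↔
      D ∈ spanning m (n + 1) ∧ ∃ i ∈ S, (i, Fin.last n) ∈ D := by
  rw [mem_spanning, mem_spanning]
  constructor
  · rintro ⟨h, hcol⟩
    obtain ⟨s, hs⟩ := hcol (Fin.last _)
    have hcol' : ∀ j, ∃ i, (i, j) ∈ D := fun j => by simpa using hcol j.castSucc
    obtain ⟨d, hd⟩ := hcol' 0
    obtain ⟨h1, h2⟩ := (isConnSet_KP_snocCol ⟨s, by simpa using hs⟩ ⟨_, hd⟩).1 h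
    exact ⟨⟨h1, hcol'⟩, h2⟩
  · rintro ⟨⟨h, hcol⟩, i, hi, hiD⟩
    refine ⟨(isConnSet_KP_snocCol ⟨i, hi⟩ ⟨_, hiD⟩).2 ⟨h, i, hi, hiD⟩, fun j => ?_⟩
    induction j using Fin.lastCases with
    | last => exact ⟨i, by simpa using hi⟩
    | cast j => simpa using hcol j

lemma nonempty_of_snocCol_mem_spanning {D : Finset (Fin m × Fin n)} {S : Finset (Fin m)}
    (h : snocCol D S ∈ spanning m (n + 1)) : S.Nonempty := by
  obtain ⟨i, hi⟩ := (mem_spanning.1 h).2 (Fin.last n)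
  exact ⟨i, by simpa using hi⟩

lemma snocCol_snocCol_mem_spanning {D : Finset (Fin m × Fin n)} {S T : Finset (Fin m)} :
    snocCol (snocCol D T) S ∈ spanning m (n + 2) ↔
      snocCol D T ∈ spanning m (n + 1) ∧ (T ∩ S).Nonempty := by
  rw [snocCol_mem_spanning]
  simp [Finset.Nonempty, and_comm]

end spanning

-- Exact counts and the recurrence.

section counting

/-- A set of vertices amounts to its last column and the remaining columns. -/
def snocColEquiv (m n : ℕ) :
    Finset (Fin m × Fin n) × Finset (Fin m) ≃ Finset (Fin m × Fin (n + 1)) where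
  toFun p := snocCol p.1 p.2
  invFun C := (Finset.univ.filter fun p => (p.1, p.2.castSucc) ∈ C,
    Finset.univ.filter fun i => (i, Fin.last n) ∈ C)
  left_inv p := by ext <;> simp
  right_inv C := by
    ext ⟨i, j⟩
    induction j using Fin.lastCases <;> simp

lemma exists_eq_snocCol {m n : ℕ} (C : Finset (Fin m × Fin (n + 1))) :
    ∃ D S, C = snocCol D S := by
  obtain ⟨⟨D, S⟩, rfl⟩ := (snocColEquiv m n).surjective C
  exact ⟨D, S, rfl⟩

lemma snocCol_inj {m n : ℕ} {D D' : Finset (Fin m × Fin n)} {S S' : Finset (Fin m)} :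
    snocCol D S = snocCol D' S' ↔ D = D' ∧ S = S' := by
  rw [← Prod.mk.injEq]
  exact (snocColEquiv m n).injective.eq_iff (a := (D, S)) (b := (D', S'))

lemma card_filter_eq_sum_snocCol {m n : ℕ} (p : Finset (Fin m × Fin (n + 1)) → Prop)
    [DecidablePred p] :
    (Finset.univ.filter p).card =
      ∑ T : Finset (Fin m), (Finset.univ.filter fun D : Finset (Fin m × Fin n) =>
        p (snocCol D T)).card := by
  simp only [Finset.card_filter]
  rw [← (snocColEquiv m n).sum_comp, Fintype.sum_prod_type_right]
  rfl

/-- For empty `T` the relation `Agrees` would impose nothing, hence the nonemptiness. -/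
lemma agrees_col_last {m n : ℕ} {D : Finset (Fin m × Fin n)} {S T : Finset (Fin m)}
    (hT : T.Nonempty) : Agrees (snocCol D S) (col (Fin.last n) T) ↔ S = T := by
  obtain ⟨t, ht⟩ := hT
  constructor
  · intro h
    ext i
    simpa [col] using h (Fin.last n) ⟨t, by simpa [col] using ht⟩ i
  · rintro rfl j ⟨i, hi⟩ i'
    obtain rfl : j = Fin.last n := by simpa [col] using (Finset.mem_product.1 hi).2
    simp [col]

open Classical in
lemma card_filter_agrees {m n : ℕ} (F : Finset (Finset (Fin m × Fin (n + 1))))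
    {T : Finset (Fin m)} (hT : T.Nonempty) :
    (F.filter fun C => Agrees C (col (Fin.last n) T)).card =
      (Finset.univ.filter fun D => snocCol D T ∈ F).card := by
  symm
  refine Finset.card_bij (fun D _ => snocCol D T) (fun D hD => ?_) (fun D _ D' _ h => ?_)
    fun C hC => ?_
  · exact Finset.mem_filter.2 ⟨(Finset.mem_filter.1 hD).2, (agrees_col_last hT).2 rfl⟩
  · exact (snocCol_inj.1 h).1
  · obtain ⟨D, S, rfl⟩ := exists_eq_snocCol C
    obtain ⟨hF, hA⟩ := Finset.mem_filter.1 hC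
    obtain rfl := (agrees_col_last hT).1 hA
    exact ⟨D, by simpa using hF, rfl⟩

lemma agrees_col_two {m : ℕ} {C : Finset (Fin m × Fin 2)} {S T : Finset (Fin m)}
    (hS : S.Nonempty) (hT : T.Nonempty) :
    Agrees C (col 1 S ∪ col 0 T) ↔ C = col 1 S ∪ col 0 T := by
  refine ⟨fun h => ?_, fun h j _ i => by rw [h]⟩
  obtain ⟨s, hs⟩ := hS
  obtain ⟨t, ht⟩ := hT
  ext ⟨i, j⟩
  refine h j ?_ i
  fin_cases j
  · exact ⟨t, by simpa [col] using ht⟩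
  · exact ⟨s, by simpa [col] using hs⟩

open Classical in
/-- The number of members of `C_{m,n+1}` with last column `T`. -/
noncomputable def cardK (m n : ℕ) (T : Finset (Fin m)) : ℕ :=
  (Finset.univ.filter fun D : Finset (Fin m × Fin n) => snocCol D T ∈ spanning m (n + 1)).card

open Classical in
/-- The number of members of `C'_{m,n+1}` with last column `S`. -/
noncomputable def cardOne (m n : ℕ) (S : Finset (Fin m)) : ℕ :=
  (Finset.univ.filter fun D : Finset (Fin m × Fin n) => snocCol D S ∈ spanning' m (n + 1)).card

open Classical in
/-- The number of members of `C'_{m,n+2}` with last columns `T`, `S`. -/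
noncomputable def cardTwo (m n : ℕ) (S T : Finset (Fin m)) : ℕ :=
  (Finset.univ.filter fun D : Finset (Fin m × Fin n) =>
    snocCol (snocCol D T) S ∈ spanning' m (n + 2)).card

lemma countK_eq {m n : ℕ} {T : Finset (Fin m)} (hT : T.Nonempty) :
    countK m (n + 1) (col (Fin.last n) T) = cardK m n T :=
  card_filter_agrees _ hT

lemma countK'_one_eq {m : ℕ} {S : Finset (Fin m)} (hS : S.Nonempty) :
    countK' m 1 (col 0 S) = cardOne m 0 S :=
  card_filter_agrees (n := 0) _ hS

lemma countK'_two_eq {m : ℕ} {S T : Finset (Fin m)} (hS : S.Nonempty) (hT : T.Nonempty) :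
    countK' m 2 (col 1 S ∪ col 0 T) = cardTwo m 0 S T := by
  classical
  have h : ∀ D : Finset (Fin m × Fin 0), snocCol (snocCol D T) S = col 1 S ∪ col 0 T := by
    intro D
    ext ⟨i, j⟩
    induction j using Fin.lastCases with
    | last => rw [mem_snocCol_last]; simp [col]
    | cast j =>
      obtain rfl : j = Fin.last 0 := Subsingleton.elim _ _
      rw [mem_snocCol_castSucc, mem_snocCol_last]; simp [col]
  simp only [countK', cardTwo, agrees_col_two hS hT, h]
  by_cases hm : col 1 S ∪ col 0 T ∈ spanning' m 2
  · simp [hm, Finset.filter_eq']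
  · simp [hm, Finset.filter_eq']

lemma cardOne_succ (m n : ℕ) (S : Finset (Fin m)) :
    cardOne m (n + 1) S = ∑ T : Finset (Fin m), cardTwo m n S T := by
  classical
  exact card_filter_eq_sum_snocCol fun D => snocCol D S ∈ spanning' m (n + 2)

lemma card_spanning'_succ (m n : ℕ) :
    (spanning' m (n + 1)).card = ∑ S : Finset (Fin m), cardOne m n S := by
  classical
  rw [← Finset.filter_univ_mem (spanning' m (n + 1)), card_filter_eq_sum_snocCol]
  exact Finset.sum_congr rfl fun S _ => by unfold cardOne; congr 1

lemma nonempty_of_cardOne_ne_zero {m n : ℕ} {S : Finset (Fin m)} (h : cardOne m n S ≠ 0) :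
    S.Nonempty := by
  classical
  obtain ⟨D, hD⟩ := Finset.card_ne_zero.1 h
  exact nonempty_of_snocCol_mem_spanning (mem_spanning'.1 (Finset.mem_filter.1 hD).2).1

lemma inter_nonempty_of_cardTwo_ne_zero {m n : ℕ} {S T : Finset (Fin m)}
    (h : cardTwo m n S T ≠ 0) : (T ∩ S).Nonempty := by
  classical
  obtain ⟨D, hD⟩ := Finset.card_ne_zero.1 h
  exact (snocCol_snocCol_mem_spanning.1 (mem_spanning'.1 (Finset.mem_filter.1 hD).2).1).2

/-- `a` is a lower bound for `b`, and it is exact if `m ≤ 4`. -/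
def LowerBound (m a b : ℕ) : Prop :=
  a ≤ b ∧ (m ≤ 4 → a = b)

lemma LowerBound.of_eq {m a b : ℕ} (h : a = b) : LowerBound m a b :=
  ⟨h.le, fun _ => h⟩

lemma LowerBound.trans_eq {m a b c : ℕ} (h : LowerBound m a b) (h' : b = c) :
    LowerBound m a c :=
  h' ▸ h

/-- Terms violating `p` vanish on the exact side, so the restricted sum loses nothing. -/
lemma LowerBound.sum {ι : Type*} [Fintype ι] {m : ℕ} {f g : ι → ℕ} {p : ι → Prop}
    [DecidablePred p] (hg : ∀ i, g i ≠ 0 → p i) (h : ∀ i, p i → LowerBound m (f i) (g i)) :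
    LowerBound m (∑ i ∈ Finset.univ.filter p, f i) (∑ i, g i) := by
  rw [← Finset.sum_filter_of_ne (fun i _ hi => hg i hi)]
  exact ⟨Finset.sum_le_sum fun i hi => (h i (Finset.mem_filter.1 hi).2).1,
    fun hm => Finset.sum_congr rfl fun i hi => (h i (Finset.mem_filter.1 hi).2).2 hm⟩

lemma lowerOne_succ {m n : ℕ} (ih : ∀ S T : Finset (Fin m), (T ∩ S).Nonempty →
      LowerBound m (lowerTwo m (n + 2) S T) (cardTwo m n S T)) (S : Finset (Fin m)) :
    LowerBound m (lowerOne m (n + 2) S) (cardOne m (n + 1) S) := by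
  classical
  rw [lowerOne, cardOne_succ]
  convert LowerBound.sum (fun T => inter_nonempty_of_cardTwo_ne_zero) (ih S)

lemma lowerTwo_succ {m n : ℕ}
    (ih0 : ∀ S : Finset (Fin m), S.Nonempty →
      LowerBound m (lowerOne m (n + 1) S) (cardOne m n S))
    (ih1 : ∀ S : Finset (Fin m), LowerBound m (lowerOne m (n + 2) S) (cardOne m (n + 1) S))
    (ih2 : ∀ S T : Finset (Fin m), (T ∩ S).Nonempty →
      LowerBound m (lowerTwo m (n + 2) S T) (cardTwo m n S T))
    {S T : Finset (Fin m)} (hST : (T ∩ S).Nonempty) :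
    LowerBound m (lowerTwo m (n + 3) S T) (cardTwo m (n + 1) S T) := by
  classical
  have hT : T.Nonempty := hST.mono Finset.inter_subset_left
  rw [lowerTwo]
  split_ifs with h1 h2
  · refine .of_eq ((countK_eq hT).trans ?_)
    unfold cardK cardTwo
    congr 1
    ext D
    obtain ⟨D, X, rfl⟩ := exists_eq_snocCol D
    simp only [Finset.mem_filter, Finset.mem_univ, true_and, mem_spanning',
      snocCol_snocCol_mem_spanning (S := S), hST, and_true, not_isConnSet_wST hT h1,
      not_false_eq_true]
  · refine (ih1 T).trans_eq ?_
    unfold cardOne cardTwo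
    congr 1
    ext D
    obtain ⟨D, X, rfl⟩ := exists_eq_snocCol D
    simp only [Finset.mem_filter, Finset.mem_univ, true_and, mem_spanning',
      snocCol_snocCol_mem_spanning (S := S), hST, and_true, isConnSet_wST_iff hT h1 h2]
  · have hsum : cardTwo m (n + 1) S T = ∑ X : Finset (Fin m),
        (Finset.univ.filter fun D : Finset (Fin m × Fin n) =>
          snocCol (snocCol (snocCol D X) T) S ∈ spanning' m (n + 3)).card :=
      card_filter_eq_sum_snocCol fun D => snocCol (snocCol D T) S ∈ spanning' m (n + 3)
    rw [hsum]
    have hmem : ∀ {X : Finset (Fin m)} {D : Finset (Fin m × Fin n)},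
        snocCol (snocCol (snocCol D X) T) S ∈ spanning m (n + 3) ↔
          snocCol D X ∈ spanning m (n + 1) ∧ (X ∩ T).Nonempty := by
      intro X D
      rw [snocCol_snocCol_mem_spanning (S := S), snocCol_snocCol_mem_spanning (S := T)]
      exact and_iff_left hST
    have main : ∀ X : Finset (Fin m), (X ∩ T).Nonempty → LowerBound m
        (if SharesComp (PP m 3) (wST S T) (wSTX S T X) then
          countK m (n + 1) (col (Fin.last n) X)
        else if (comps (PP m 3) (wSTX S T X)).card = (comps (PP m 3) (wX X)).card then
          lowerOne m (n + 1) X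
        else if Consecutive S T X then lowerTwo m (n + 2) (fill S T X) X
        else 0)
        (Finset.univ.filter fun D : Finset (Fin m × Fin n) =>
          snocCol (snocCol (snocCol D X) T) S ∈ spanning' m (n + 3)).card := by
      intro X hXT
      have hX : X.Nonempty := hXT.mono Finset.inter_subset_left
      split_ifs with h3 h4 h5
      · refine .of_eq ((countK_eq hX).trans ?_)
        unfold cardK
        simp only [mem_spanning' (n := n + 3), hmem, hXT, and_true, not_isConnSet_wSTX hX h3,
          not_false_eq_true]
      · refine (ih0 X hX).trans_eq ?_
        unfold cardOne
        simp only [mem_spanning', hmem, hXT, and_true, isConnSet_wSTX_iff hX h3 h4]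
      · have hXF : (X ∩ fill S T X).Nonempty := by
          rwa [Finset.inter_eq_left.2 subset_fill]
        refine (ih2 _ X hXF).trans_eq ?_
        unfold cardTwo
        simp only [mem_spanning', hmem, hXT, and_true, isConnSet_fill_iff hX h3 h5,
          snocCol_snocCol_mem_spanning (n := n), hXF]
      · exact ⟨Nat.zero_le _, fun hm => absurd (consecutive_of_le_four hm) h5⟩
    convert LowerBound.sum (p := fun X : Finset (Fin m) => (X ∩ T).Nonempty) (fun X hX => ?_) main
    obtain ⟨D, hD⟩ := Finset.card_ne_zero.1 hX
    exact (hmem.1 (mem_spanning'.1 (Finset.mem_filter.1 hD).2).1).2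

lemma lowerBound_lower (m n : ℕ) :
    (∀ S : Finset (Fin m), S.Nonempty → LowerBound m (lowerOne m (n + 1) S) (cardOne m n S)) ∧
    ∀ S T : Finset (Fin m), (T ∩ S).Nonempty →
      LowerBound m (lowerTwo m (n + 2) S T) (cardTwo m n S T) := by
  induction n with
  | zero =>
    refine ⟨fun S hS => ?_, fun S T hST => ?_⟩
    · rw [lowerOne]
      exact .of_eq (countK'_one_eq hS)
    · rw [lowerTwo]
      exact .of_eq (countK'_two_eq (hST.mono Finset.inter_subset_right)
        (hST.mono Finset.inter_subset_left))
  | succ n ih =>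
    have h1 := lowerOne_succ ih.2
    exact ⟨fun S _ => h1 S, fun S T hST => lowerTwo_succ ih.1 h1 ih.2 hST⟩

lemma lowerBound_NK' (m : ℕ) {n : ℕ} (hn : 0 < n) :
    LowerBound m (NK' m n) (spanning' m n).card := by
  classical
  obtain ⟨n, rfl⟩ : ∃ k, n = k + 1 := ⟨n - 1, by omega⟩
  rw [NK', card_spanning'_succ]
  convert LowerBound.sum (fun S => nonempty_of_cardOne_ne_zero) (lowerBound_lower m n).1

end counting

-- Translating connected sets of the grid.

section numConn

variable {m n : ℕ}

open Classical in
/-- The connected sets of `P_m × P_n` that meet every column. -/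
noncomputable def spanningPP (m n : ℕ) : Finset (Finset (Fin m × Fin n)) :=
  (spanning m n).filter fun C => IsConnSet (PP m n) C

lemma mem_spanningPP {C : Finset (Fin m × Fin n)} :
    C ∈ spanningPP m n ↔ IsConnSet (PP m n) C ∧ ∀ j, ∃ i, (i, j) ∈ C := by
  classical
  rw [spanningPP, Finset.mem_filter, mem_spanning]
  exact ⟨fun h => ⟨h.2, h.1.2⟩, fun h => ⟨⟨h.1.mono_graph (PP_le_KP m n), h.2⟩, h.1⟩⟩

lemma card_spanningPP_add (m n : ℕ) :
    (spanningPP m n).card + (spanning' m n).card = NK m n := by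
  classical
  rw [spanningPP, spanning', NK]
  exact Finset.card_filter_add_card_filter_not _

lemma IsConnSet.exists_mem_column {C : Finset (Fin m × Fin n)} (hC : IsConnSet (PP m n) C)
    {p q : Fin m × Fin n} (hp : p ∈ C) (hq : q ∈ C) {j : Fin n} (hpj : p.2 ≤ j)
    (hjq : j ≤ q.2) : ∃ i, (i, j) ∈ C := by
  by_contra! hno
  have hne : ∀ z ∈ C, z.2.val ≠ j.val := fun z hz h =>
    hno z.1 (by rw [← Fin.ext h]; exact hz)
  have := ((isConnSet_iff.1 hC).2 p hp q hq).propagate (p := fun v => v.2.val < j.val)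
    (lt_of_le_of_ne hpj (hne p hp)) (by
      intro a b _ hb hab _ ha
      have := hne b hb
      rw [PP_adj, Fin.ext_iff (a := a.2)] at hab
      omega)
  exact absurd this (not_lt.2 hjq)

/-- The copy of `D` in `P_m × P_n` that starts at the column `s`. -/
def copyAt {k : ℕ} (n s : ℕ) (D : Finset (Fin m × Fin k)) : Finset (Fin m × Fin n) :=
  Finset.univ.filter fun p => (p.1, p.2.val) ∈ place s D

lemma place_copyAt {k s : ℕ} (h : k + s ≤ n) (D : Finset (Fin m × Fin k)) :
    place 0 (copyAt n s D) = place s D := by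
  ext ⟨i, j⟩
  rw [mem_place]
  constructor
  · rintro ⟨l, hl, rfl⟩
    simpa [copyAt] using hl
  · intro hj
    exact ⟨⟨j, (lt_of_mem_place hj).trans_le h⟩, by simpa [copyAt] using hj, rfl⟩

/-- Compares the first and last occupied columns; used in both directions it makes the width and the
position of a translate unique. -/
lemma le_of_place_eq {k k' s s' : ℕ} {D : Finset (Fin m × Fin k)} {D' : Finset (Fin m × Fin k')}
    (hk : 1 ≤ k) (hD : ∀ j, ∃ i, (i, j) ∈ D) (h : place s D = place s' D') :
    s' ≤ s ∧ k + s ≤ k' + s' := by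
  obtain ⟨i, hi⟩ := hD ⟨0, hk⟩
  obtain ⟨i', hi'⟩ := hD ⟨k - 1, by omega⟩
  have h1 : (i, 0 + s) ∈ place s' D' := h ▸ mem_place.2 ⟨_, hi, rfl⟩
  have h2 : (i', k - 1 + s) ∈ place s' D' := h ▸ mem_place.2 ⟨_, hi', rfl⟩
  obtain ⟨l, -, hl⟩ := mem_place.1 h1
  have := lt_of_mem_place h2
  omega

lemma exists_copyAt_eq {C : Finset (Fin m × Fin n)} (hC : IsConnSet (PP m n) C) :
    ∃ k s, 1 ≤ k ∧ k + s ≤ n ∧ ∃ D ∈ spanningPP m k, copyAt n s D = C := by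
  have hne := (isConnSet_iff.1 hC).1
  obtain ⟨p, hp, hpmin⟩ := C.exists_min_image (fun z => z.2.val) hne
  obtain ⟨q, hq, hqmax⟩ := C.exists_max_image (fun z => z.2.val) hne
  have hpq := hpmin q hq
  -- `p` and `q` lie in the extreme columns of `C`; `D` is `C` moved left until it starts at column
  -- `0`.
  let D : Finset (Fin m × Fin (q.2.val - p.2.val + 1)) :=
    Finset.univ.filter fun z => (z.1, z.2.val + p.2.val) ∈ place 0 C
  have hle : q.2.val - p.2.val + 1 + p.2.val ≤ n := by omega
  have hplace : place p.2.val D = place 0 C := by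
    ext ⟨i, j⟩
    rw [mem_place]
    constructor
    · rintro ⟨l, hl, rfl⟩
      simpa [D] using hl
    · intro h
      obtain ⟨l, hl, rfl⟩ := mem_place.1 h
      have h1 := hpmin _ hl
      have h2 := hqmax _ hl
      simp only at h1 h2
      have he : l.val - p.2.val + p.2.val = l.val + 0 := by omega
      exact ⟨⟨l.val - p.2.val, by omega⟩, by simpa only [D, Finset.mem_filter, Finset.mem_univ,
        true_and, he] using h, he⟩
  refine ⟨_, p.2.val, Nat.succ_pos _, hle, D, mem_spanningPP.2 ⟨?_, fun j => ?_⟩, ?_⟩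
  · rwa [← isConnSet_place p.2.val, hplace, isConnSet_place]
  · obtain ⟨i, hi⟩ := hC.exists_mem_column hp hq (j := ⟨j.val + p.2.val, by omega⟩)
      (by rw [Fin.le_def]; simp) (by rw [Fin.le_def]; simp only; omega)
    refine ⟨i, ?_⟩
    simp only [D, Finset.mem_filter, Finset.mem_univ, true_and]
    exact mem_place.2 ⟨_, hi, rfl⟩
  · refine Finset.map_injective (shift m n 0).toEmbedding ?_
    exact (place_copyAt hle D).trans hplace

lemma numConn_PP (m n : ℕ) : numConn (PP m n) =
    ∑ k ∈ Finset.Icc 1 n, (n - k + 1) * (spanningPP m k).card := by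
  classical
  have hcard : ∀ k, (n - k + 1) * (spanningPP m k).card =
      (Finset.range (n - k + 1) ×ˢ spanningPP m k).card := fun k => by
    rw [Finset.card_product, Finset.card_range]
  simp only [hcard]
  rw [← Finset.card_sigma, numConn]
  symm
  have hle : ∀ {a : Σ k : ℕ, ℕ × Finset (Fin m × Fin k)},
      a ∈ (Finset.Icc 1 n).sigma (fun k => Finset.range (n - k + 1) ×ˢ spanningPP m k) →
      1 ≤ a.1 ∧ a.1 + a.2.1 ≤ n ∧ a.2.2 ∈ spanningPP m a.1 := by
    intro a ha
    simp only [Finset.mem_sigma, Finset.mem_Icc, Finset.mem_product, Finset.mem_range] at ha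
    exact ⟨ha.1.1, by omega, ha.2.2⟩
  refine Finset.card_bij (fun a _ => copyAt n a.2.1 a.2.2) (fun a ha => ?_)
    (fun a ha b hb hab => ?_) fun C hC => ?_
  · obtain ⟨-, h, hD⟩ := hle ha
    rw [Finset.mem_filter]
    refine ⟨Finset.mem_univ _, ?_⟩
    rw [← isConnSet_place 0, place_copyAt h, isConnSet_place]
    exact (mem_spanningPP.1 hD).1
  · obtain ⟨h1, h, hD⟩ := hle ha
    obtain ⟨h1', h', hD'⟩ := hle hb
    obtain ⟨k, s, D⟩ := a
    obtain ⟨k', s', D'⟩ := b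
    simp only at h1 h hD h1' h' hD' hab
    have he : place s D = place s' D' := by
      rw [← place_copyAt h, ← place_copyAt h', hab]
    have := le_of_place_eq h1 (mem_spanningPP.1 hD).2 he
    have := le_of_place_eq h1' (mem_spanningPP.1 hD').2 he.symm
    obtain rfl : k = k' := by omega
    obtain rfl : s = s' := by omega
    rw [Finset.map_injective (shift m k s).toEmbedding he]
  · obtain ⟨k, s, hk, hks, D, hD, rfl⟩ := exists_copyAt_eq (Finset.mem_filter.1 hC).2
    refine ⟨⟨k, s, D⟩, ?_, rfl⟩
    simp only [Finset.mem_sigma, Finset.mem_Icc, Finset.mem_product, Finset.mem_range]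
    exact ⟨⟨hk, by omega⟩, by omega, hD⟩

lemma numConn_PP_cast (m n : ℕ) : (numConn (PP m n) : ℤ) =
    ∑ k ∈ Finset.Icc 1 n, ((NK m k : ℤ) - ((spanning' m k).card : ℤ)) *
      ((n : ℤ) - (k : ℤ) + 1) := by
  rw [numConn_PP, Nat.cast_sum]
  refine Finset.sum_congr rfl fun k hk => ?_
  have h := (Finset.mem_Icc.1 hk).2
  rw [← card_spanningPP_add, Nat.cast_mul, mul_comm]
  -- `k ≤ n` makes the truncated difference `n - k` a true one.
  push_cast [h]
  ring

end numConn

end GridConn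

theorem theorem3p3 (m n : ℕ) (hm : 0 < m) (hn : 0 < n) :
    GridConn.NK' m n ≤ (GridConn.spanning' m n).card ∧
    (GridConn.numConn (GridConn.PP m n) : ℤ) ≤
      ∑ k ∈ Finset.Icc 1 n,
        ((GridConn.NK m k : ℤ) - (GridConn.NK' m k : ℤ)) * ((n : ℤ) - (k : ℤ) + 1) ∧
    (m = 3 ∨ m = 4 →
      (GridConn.numConn (GridConn.PP m n) : ℤ) =
        ∑ k ∈ Finset.Icc 1 n,
          ((GridConn.NK m k : ℤ) - (GridConn.NK' m k : ℤ)) * ((n : ℤ) - (k : ℤ) + 1)) := by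
  refine ⟨(GridConn.lowerBound_NK' m hn).1, ?_, fun h34 => ?_⟩
  · rw [GridConn.numConn_PP_cast]
    refine Finset.sum_le_sum fun k hk => ?_
    obtain ⟨hk1, hkn⟩ := Finset.mem_Icc.1 hk
    have := (GridConn.lowerBound_NK' m hk1).1
    refine mul_le_mul_of_nonneg_right ?_ (by omega)
    omega
  · rw [GridConn.numConn_PP_cast]
    refine Finset.sum_congr rfl fun k hk => ?_
    rw [(GridConn.lowerBound_NK' m (Finset.mem_Icc.1 hk).1).2 (by omega)]
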